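/- Maps are finite, and loops and multiple edges are allowed. A plane map is a proper embedding of a connected graph in the plane, considered up to orientation-preserving homeomorphism; its unbounded face is called the outer face. Let $k\ge 1$. A $k$-fractional orientation $O$ of a plane map assigns to each edge $k$ units of orientation, distributed between its two directions; ordinary orientations are the case $k=1$. An edge is at least partially oriented in a direction if that direction receives at least one unit, and saturated if all $k$ units go to one direction. An oriented path or cycle is one in which each edge is at least partially oriented in the direction of traversal. A simple cycle with a direction of traversal is clockwise (resp. counterclockwise) if the outer face is on its left (resp. on its right). The orientation $O$ is minimal if it has no counterclockwise simple oriented cycle, and accessible with respect to a vertex $r$ if there is an oriented path from every vertex to $r$. **Theorem.** Let $M$ be a plane map rooted at an arbitrary vertex $r$ (not necessarily incident to the outer face), endowed with a minimal accessible $k$-fractional orientation $O$. Then there is exactly one partition of the edges of $M$ into two (possibly empty) sets $(T,C)$ such that - the edges of $T$ form a spanning tree of $M$, rooted at $r$, on which the restriction of $O$ is accessible: from every vertex there is an oriented path to $r$ that uses only edges of $T$; - every edge $e\in C$ (called a closure edge) is saturated, and the unique cycle that $e$ forms with edges of $T$, traversed in the direction of $e$, is clockwise. -/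

import Mathlib

/-- Half-edges (darts): an edge together with one of its two directions of traversal. Which of the
two directions is called `true` has no meaning. -/
abbrev Dart (E : Type*) : Type _ := E × Bool

/-- The same edge traversed in the other direction. -/
def Dart.rev {E : Type*} (d : Dart E) : Dart E := (d.1, !d.2)

/-- A plane map with vertices `V`, edges `E` and faces `F` (loops, multiple edges and bridges
allowed), considered up to orientation-preserving homeomorphism, that is: a finite connected graph,
the clockwise cyclic order of the half-edges around each vertex, the faces, such that the surface so
described is the sphere (Euler's formula), and a marked face, the unbounded one. -/
structure PlaneMap (V E F : Type*) [Finite V] [Finite E] [Finite F] where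
  /-- the vertex from which a half-edge starts -/
  org : Dart E → V
  /-- the next half-edge in clockwise order around the starting vertex -/
  cw : Equiv.Perm (Dart E)
  /-- the face on the left of an edge traversed in the given direction -/
  left : Dart E → F
  /-- the unbounded face -/
  outer : F
  /-- the half-edges starting from a vertex form one cycle of the rotation -/
  org_eq_iff : ∀ d d' : Dart E, org d = org d' ↔ cw.SameCycle d d'
  /-- Faces are the orbits of the boundary walk that keeps the face on the left: after traversing
  `d`, continue along the half-edge that follows `d.rev` in clockwise order around the vertex
  reached. -/
  left_eq_iff : ∀ d d' : Dart E,
    left d = left d' ↔ ∃ n : ℕ, (fun x : Dart E => cw x.rev)^[n] d = d'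
  /-- every face is bordered by an edge, unless the map is reduced to a vertex -/
  left_surj : Nonempty E → Function.Surjective left
  /-- the underlying graph is connected -/
  nonempty : Nonempty V
  connected : ∀ u v : V,
    Relation.ReflTransGen (fun a b => ∃ d : Dart E, org d = a ∧ org d.rev = b) u v
  /-- the genus is zero -/
  euler : Nat.card V + Nat.card F = Nat.card E + 2

/-- A `k`-fractional orientation with edge set `E`: each edge is replaced by `k` copies, of which
`weight d` are oriented as `d` and the others as `d.rev`. Ordinary orientations are the case
`k = 1`. -/
structure FracOrientation (E : Type*) (k : ℕ) where
  weight : Dart E → ℕ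
  weight_add : ∀ d : Dart E, weight d + weight d.rev = k

namespace FracOrientation

variable {E : Type*} {k : ℕ}

/-- The edge of `d` is at least partially oriented in the direction `d`. -/
def Along (O : FracOrientation E k) (d : Dart E) : Prop := 0 < O.weight d

/-- The edge of `d` is totally oriented in the direction `d`. -/
def SaturatedAlong (O : FracOrientation E k) (d : Dart E) : Prop := O.weight d = k

end FracOrientation

namespace PlaneMap

variable {V E F : Type*} [Finite V] [Finite E] [Finite F]

/-- The vertex at which a half-edge, traversed from its starting vertex, arrives. -/
def tgt (M : PlaneMap V E F) (d : Dart E) : V := M.org d.rev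

/-- The face on the right of an edge traversed in the given direction. -/
def right (M : PlaneMap V E F) (d : Dart E) : F := M.left d.rev

/-- A simple cycle of the underlying graph with a direction of traversal (and a starting point):
`n + 1` edges are traversed one after the other (the indices are cyclic), without repetition of
vertices or edges. Loops are the case `n = 0`. -/
structure IsSimpleCycle (M : PlaneMap V E F) {n : ℕ} (c : Fin (n + 1) → Dart E) : Prop where
  step : ∀ i, M.tgt (c i) = M.org (c (i + 1))
  vertex_inj : Function.Injective fun i => M.org (c i)
  edge_inj : Function.Injective fun i => (c i).1

/-- The faces `f` and `g` are in the same connected component of the complement of the edges in `S`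
and their endpoints, when `S` is the set of edges of a cycle: one can go from `f` to `g` by crossing
edges that are not in `S`. -/
def SameSide (M : PlaneMap V E F) (S : Set E) (f g : F) : Prop :=
  Relation.ReflTransGen (fun a b => ∃ d : Dart E, d.1 ∉ S ∧ M.left d = a ∧ M.right d = b) f g

/-- The cycle is traversed clockwise: the outer face is on its left. -/
def IsClockwise (M : PlaneMap V E F) {n : ℕ} (c : Fin (n + 1) → Dart E) : Prop :=
  ∃ i, M.SameSide (Set.range fun j => (c j).1) (M.left (c i)) M.outer

/-- The cycle is traversed counterclockwise: the outer face is on its right. -/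
def IsCounterclockwise (M : PlaneMap V E F) {n : ℕ} (c : Fin (n + 1) → Dart E) : Prop :=
  ∃ i, M.SameSide (Set.range fun j => (c j).1) (M.right (c i)) M.outer

/-- An orientation is minimal if it has no counterclockwise simple oriented cycle. -/
def Minimal (M : PlaneMap V E F) {k : ℕ} (O : FracOrientation E k) : Prop :=
  ¬ ∃ (n : ℕ) (c : Fin (n + 1) → Dart E),
    M.IsSimpleCycle c ∧ (∀ i, O.Along (c i)) ∧ M.IsCounterclockwise c

/-- The restriction of `O` to the edges in `S` is accessible: there is an oriented path with edges
in `S` from every vertex to the root `r`. -/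
def AccessibleOn (M : PlaneMap V E F) {k : ℕ} (O : FracOrientation E k) (r : V) (S : Set E) :
    Prop :=
  ∀ v : V, Relation.ReflTransGen
    (fun a b => ∃ d : Dart E, d.1 ∈ S ∧ O.Along d ∧ M.org d = a ∧ M.tgt d = b) v r

/-- Every vertex is joined to the root `r` by an oriented path. -/
def Accessible (M : PlaneMap V E F) {k : ℕ} (O : FracOrientation E k) (r : V) : Prop :=
  M.AccessibleOn O r Set.univ

/-- The edges in `T` form a spanning tree: they connect all the vertices and contain no cycle. -/
structure IsSpanningTree (M : PlaneMap V E F) (T : Set E) : Prop where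
  connected : ∀ u v : V, Relation.ReflTransGen
    (fun a b => ∃ d : Dart E, d.1 ∈ T ∧ M.org d = a ∧ M.tgt d = b) u v
  acyclic : ¬ ∃ (n : ℕ) (c : Fin (n + 1) → Dart E), M.IsSimpleCycle c ∧ ∀ i, (c i).1 ∈ T

/-- For a spanning tree `T` and an edge `e` outside of it: `e` is saturated, and the cycle that it
forms with edges of `T`, when traversed in the direction in which `e` is oriented, is clockwise. -/
def IsSaturatedClockwise (M : PlaneMap V E F) {k : ℕ} (O : FracOrientation E k) (T : Set E)
    (e : E) : Prop :=
  ∃ d : Dart E, d.1 = e ∧ O.SaturatedAlong d ∧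
    ∃ (n : ℕ) (c : Fin (n + 1) → Dart E), M.IsSimpleCycle c ∧ (∃ i, c i = d) ∧
      (∀ i, (c i).1 ∈ insert e T) ∧ M.IsClockwise c

/-- `T` (tree edges) and `C` (closure edges) form a tree-and-closure partition of the edges of the
map `M` rooted at `r` and oriented by `O`. -/
structure IsTreeClosurePartition (M : PlaneMap V E F) {k : ℕ} (O : FracOrientation E k) (r : V)
    (T C : Set E) : Prop where
  union_eq : T ∪ C = Set.univ
  disjoint : Disjoint T C
  tree : M.IsSpanningTree T
  accessible : M.AccessibleOn O r T
  closure : ∀ e ∈ C, M.IsSaturatedClockwise O T e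

end PlaneMap

/-! Fix an antisymmetric `y` on half-edges whose sum along a simple cycle is, up to sign, the number
of faces that the cycle separates from the outer face: negative if clockwise, positive if
counterclockwise (`exists_area`). The theorem then becomes a statement about longest paths for the
lengths `y`.

Existence. By minimality no oriented cycle has positive length, so the largest length `p v` of an
oriented walk from `v` to `r` is well defined. Let `T` be the set of edges along which `p` drops by
exactly `y`. Longest walks stay in `T`, so `T` is accessible; a cycle in `T` would have length zero,
so `T` is a tree. On any other edge, `y` is strictly less than the drop of `p` in an available
direction. The opposite direction would violate the same inequality, so the edge is saturated; its
cycle with `T` has negative length and is clockwise (`IsMaxPotential.isTreeClosurePartition`).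

Uniqueness. The tree of any valid partition carries a potential `q` with differences `y`. Clockwise
closure edges make `y` at most the drop of `q` in every available direction, so tree paths are
longest and `p = q - q r`. Hence the tree consists of tight edges (`subset_tightEdges`), and a
spanning tree cannot properly contain another.

The function `y` comes from linear algebra: Euler's formula identifies circulations with
coboundaries of functions on faces, which also gives the required form of the Jordan curve theorem
(`sign_sum`). -/

/-- The value on a half-edge of the antisymmetric function that takes the value `x e` on the
half-edge `(e, true)`. -/
def Dart.signed {E : Type*} (x : E → ℝ) (d : Dart E) : ℝ := if d.2 then x d.1 else -x d.1

namespace Dart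

variable {E : Type*}

@[simp] lemma rev_rev (d : Dart E) : d.rev.rev = d := by simp [rev]

@[simp] lemma rev_fst (d : Dart E) : d.rev.1 = d.1 := rfl

/-- Reversal of half-edges, as a permutation. -/
def revPerm (E : Type*) : Equiv.Perm (Dart E) := ⟨rev, rev, rev_rev, rev_rev⟩

lemma eq_or_eq_rev {d d' : Dart E} (h : d.1 = d'.1) : d = d' ∨ d = d'.rev := by
  obtain ⟨e, b⟩ := d
  obtain ⟨e', b'⟩ := d'
  obtain rfl : e = e' := h
  cases b <;> cases b' <;> simp [rev]

lemma signed_rev (x : E → ℝ) (d : Dart E) : signed x d.rev = -signed x d := by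
  obtain ⟨e, b⟩ := d
  cases b <;> simp [signed, rev]

lemma signed_mul_signed (x z : E → ℝ) (d : Dart E) : signed x d * signed z d = x d.1 * z d.1 := by
  obtain ⟨e, b⟩ := d
  cases b <;> simp [signed]

end Dart

/-- A function on a cycle that does not change along the cycle is constant. -/
lemma Fin.apply_eq_apply_zero {α : Type*} {n : ℕ} {a : Fin (n + 1) → α}
    (h : ∀ i, a i = a (i + 1)) (i : Fin (n + 1)) : a i = a 0 := by
  induction i using Fin.induction with
  | zero => rfl
  | succ i ih => rw [← ih, h i.castSucc, Fin.coeSucc_eq_succ]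

/-- If `a` is orthogonal to all differences along a cycle, then it is constant. -/
lemma Fin.apply_eq_apply_zero_of_sum_mul_sub {n : ℕ} {a : Fin (n + 1) → ℝ}
    (h : ∑ i, a i * (a i - a (i + 1)) = 0) (i : Fin (n + 1)) : a i = a 0 := by
  refine Fin.apply_eq_apply_zero (fun j => ?_) i
  have h1 : ∑ i, a (i + 1) ^ 2 = ∑ i, a i ^ 2 :=
    Equiv.sum_comp (Equiv.addRight (1 : Fin (n + 1))) fun i => a i ^ 2
  -- Expanding the squares leaves twice the hypothesis plus a difference of two sums equal by cyclic
  -- shift.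
  have h2 : ∑ i, (a i - a (i + 1)) ^ 2 = 0 := by
    have : ∑ i, (a i - a (i + 1)) ^ 2 =
        2 * ∑ i, a i * (a i - a (i + 1)) + (∑ i, a (i + 1) ^ 2 - ∑ i, a i ^ 2) := by
      rw [Finset.mul_sum, ← Finset.sum_sub_distrib, ← Finset.sum_add_distrib]
      exact Finset.sum_congr rfl fun i _ => by ring
    rw [this, h, h1]
    ring
  have h3 := (Finset.sum_eq_zero_iff_of_nonneg fun i _ => sq_nonneg _).1 h2 j (Finset.mem_univ j)
  exact sub_eq_zero.1 (pow_eq_zero_iff two_ne_zero |>.1 h3)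

/-! ### Circulations and potentials on a sphere -/

namespace PlaneMap

section Homology

variable {V E F : Type*} [Fintype V] [Fintype E] [Fintype F] (M : PlaneMap V E F)

/-- The differences of a function on the vertices along the edges. -/
def grad : (V → ℝ) →ₗ[ℝ] (E → ℝ) where
  toFun g e := g (M.org (e, true)) - g (M.org (e, false))
  map_add' g g' := by ext e; simp only [Pi.add_apply]; ring
  map_smul' a g := by ext e; simp only [Pi.smul_apply, smul_eq_mul, RingHom.id_apply]; ring

/-- The differences of a function on the faces across the edges. -/
def cograd : (F → ℝ) →ₗ[ℝ] (E → ℝ) where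
  toFun h e := h (M.left (e, true)) - h (M.left (e, false))
  map_add' g g' := by ext e; simp only [Pi.add_apply]; ring
  map_smul' a g := by ext e; simp only [Pi.smul_apply, smul_eq_mul, RingHom.id_apply]; ring

lemma signed_grad (g : V → ℝ) (d : Dart E) :
    Dart.signed (M.grad g) d = g (M.org d) - g (M.tgt d) := by
  obtain ⟨e, b⟩ := d
  cases b <;> simp [Dart.signed, grad, tgt, Dart.rev]

lemma signed_cograd (h : F → ℝ) (d : Dart E) :
    Dart.signed (M.cograd h) d = h (M.left d) - h (M.right d) := by
  obtain ⟨e, b⟩ := d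
  cases b <;> simp [Dart.signed, cograd, right, Dart.rev]

lemma org_cw (d : Dart E) : M.org (M.cw d) = M.org d :=
  (M.org_eq_iff _ _).2 (Equiv.Perm.sameCycle_apply_left.2 (Equiv.Perm.SameCycle.refl _ _))

lemma left_cw_rev (d : Dart E) : M.left (M.cw d.rev) = M.left d :=
  ((M.left_eq_iff _ _).2 ⟨1, rfl⟩).symm

/-- The face walk `d ↦ M.cw d.rev` permutes the half-edges, preserves the left face and sends the
origin of `d` to its target; reindexing by it cancels the two halves of the sum. -/
lemma sum_cograd_mul_grad (h : F → ℝ) (g : V → ℝ) : ∑ e, M.cograd h e * M.grad g e = 0 := by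
  have key : ∑ d : Dart E, h (M.left d) * g (M.org d.rev) =
      ∑ d : Dart E, h (M.left d) * g (M.org d) := by
    rw [← Equiv.sum_comp ((Dart.revPerm E).trans M.cw) fun d => h (M.left d) * g (M.org d)]
    refine Finset.sum_congr rfl fun d _ => ?_
    change h (M.left d) * g (M.org d.rev) = h (M.left (M.cw d.rev)) * g (M.org (M.cw d.rev))
    rw [left_cw_rev, org_cw]
  have expand : ∑ e, M.cograd h e * M.grad g e =
      ∑ d : Dart E, (h (M.left d) * g (M.org d) - h (M.left d) * g (M.org d.rev)) := by
    rw [Fintype.sum_prod_type]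
    refine Finset.sum_congr rfl fun e _ => ?_
    simp only [cograd, grad, LinearMap.coe_mk, AddHom.coe_mk, Fintype.sum_bool, Dart.rev,
      Bool.not_true, Bool.not_false]
    ring
  rw [expand, Finset.sum_sub_distrib, key, sub_self]

lemma eq_of_grad_eq_zero {g : V → ℝ} (hg : M.grad g = 0) (u v : V) : g u = g v := by
  induction M.connected u v with
  | refl => rfl
  | tail _ h ih =>
    obtain ⟨d, rfl, rfl⟩ := h
    have := M.signed_grad g d
    rw [hg] at this
    rw [ih]
    refine sub_eq_zero.1 (this.symm.trans ?_)
    simp [Dart.signed]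

/-- The value on the left face is invariant under reversal, hence also under rotation about a
vertex; by connectedness these moves reach every half-edge. -/
lemma eq_of_cograd_eq_zero {h : F → ℝ} (hh : M.cograd h = 0) (f f' : F) : h f = h f' := by
  have hrev (d : Dart E) : h (M.left d.rev) = h (M.left d) := by
    have := M.signed_cograd h d
    rw [hh] at this
    refine (sub_eq_zero.1 (this.symm.trans ?_)).symm
    simp [Dart.signed]
  have hcw (d : Dart E) : h (M.left (M.cw d)) = h (M.left d) := by
    rw [← hrev d, ← M.left_cw_rev d.rev, Dart.rev_rev]
  have hzpow (d : Dart E) (n : ℤ) : h (M.left ((M.cw ^ n) d)) = h (M.left d) := by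
    induction n with
    | zero => simp
    | succ n ih => rw [add_comm, zpow_add, Equiv.Perm.mul_apply, zpow_one, hcw, ih]
    | pred n ih =>
      rw [← ih, ← hcw ((M.cw ^ (-(n : ℤ) - 1)) d), ← Equiv.Perm.mul_apply, ← zpow_one_add]
      congr 4
      ring
  have hvertex (d d' : Dart E) (hd : M.org d = M.org d') : h (M.left d) = h (M.left d') := by
    obtain ⟨n, rfl⟩ := (M.org_eq_iff d d').1 hd
    exact (hzpow d n).symm
  have hdart (u v : V) : ∀ d d' : Dart E, M.org d = u → M.org d' = v →
      h (M.left d) = h (M.left d') := by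
    induction M.connected u v with
    | refl => exact fun d d' hd hd' => hvertex d d' (hd.trans hd'.symm)
    | tail _ hstep ih =>
      obtain ⟨x, rfl, rfl⟩ := hstep
      intro d d' hd hd'
      rw [ih d x hd rfl, ← hrev x]
      exact hvertex _ _ hd'.symm
  by_cases hE : Nonempty E
  · obtain ⟨d, rfl⟩ := M.left_surj hE f
    obtain ⟨d', rfl⟩ := M.left_surj hE f'
    exact hdart _ _ d d' rfl rfl
  -- Without edges `left_surj` says nothing, and Euler's formula supplies the single face.
  · have hE' : IsEmpty E := not_nonempty_iff.1 hE
    have hV : Nat.card V = 1 := by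
      have : Subsingleton V := by
        refine ⟨fun u v => ?_⟩
        induction M.connected u v with
        | refl => rfl
        | tail _ hstep _ => exact hE'.elim hstep.choose.1
      have := M.nonempty
      exact Nat.card_unique
    have hF : Nat.card F = 1 := by
      have := M.euler
      rw [hV, Nat.card_of_isEmpty (α := E)] at this
      omega
    have : Subsingleton F := (Nat.card_eq_one_iff_unique.1 hF).1
    rw [Subsingleton.elim f f']

/-- A linear map whose kernel consists of constant functions has corank at most one. -/
lemma card_le_finrank_range_add_one {ι κ : Type*} [Fintype ι] [Fintype κ]
    (L : (ι → ℝ) →ₗ[ℝ] (κ → ℝ)) (hL : ∀ x, L x = 0 → ∀ i j, x i = x j) :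
    Fintype.card ι ≤ Module.finrank ℝ (LinearMap.range L) + 1 := by
  have h1 := LinearMap.finrank_range_add_finrank_ker L
  rw [Module.finrank_fintype_fun_eq_card] at h1
  have h2 : LinearMap.ker L ≤ Submodule.span ℝ {fun _ => (1 : ℝ)} := by
    intro x hx
    rw [Submodule.mem_span_singleton]
    rcases isEmpty_or_nonempty ι with hι | ⟨⟨i⟩⟩
    · exact ⟨0, Subsingleton.elim _ _⟩
    · refine ⟨x i, funext fun j => ?_⟩
      simpa using hL x hx i j
  have h3 := (Submodule.finrank_mono h2).trans (finrank_span_le_card _)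
  simp only [Set.toFinset_singleton, Finset.card_singleton] at h3
  omega

/-- Planarity: a circulation is the family of differences of a function on the faces. -/
lemma exists_cograd_eq {x : E → ℝ} (hx : ∀ g, ∑ e, x e * M.grad g e = 0) :
    ∃ h, M.cograd h = x := by
  classical
  let D := dotProductEquiv ℝ E
  have hle : (LinearMap.range M.cograd).map D.toLinearMap ≤
      (LinearMap.range M.grad).dualAnnihilator := by
    rintro _ ⟨_, ⟨h, rfl⟩, rfl⟩
    rw [Submodule.mem_dualAnnihilator]
    rintro _ ⟨g, rfl⟩
    exact M.sum_cograd_mul_grad h g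
  have hx' : D x ∈ (LinearMap.range M.grad).dualAnnihilator := by
    rw [Submodule.mem_dualAnnihilator]
    rintro _ ⟨g, rfl⟩
    exact hx g
  -- The annihilator has dimension at most `|E| - |V| + 1`, which is `|F| - 1` by Euler's formula,
  -- so the inclusion `hle` is an equality.
  have hcard : Module.finrank ℝ (LinearMap.range M.grad).dualAnnihilator ≤
      Module.finrank ℝ ((LinearMap.range M.cograd).map D.toLinearMap) := by
    have h1 := Subspace.finrank_add_finrank_dualAnnihilator_eq (LinearMap.range M.grad)
    have h2 := card_le_finrank_range_add_one M.grad fun g hg => M.eq_of_grad_eq_zero hg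
    have h3 := card_le_finrank_range_add_one M.cograd fun h hh => M.eq_of_cograd_eq_zero hh
    have h4 : Module.finrank ℝ ((LinearMap.range M.cograd).map D.toLinearMap) =
        Module.finrank ℝ (LinearMap.range M.cograd) := LinearEquiv.finrank_map_eq D _
    have h5 := M.euler
    rw [Nat.card_eq_fintype_card, Nat.card_eq_fintype_card, Nat.card_eq_fintype_card] at h5
    rw [Module.finrank_fintype_fun_eq_card] at h1
    omega
  rw [← Submodule.eq_of_le_of_finrank_le hle hcard] at hx'
  obtain ⟨_, ⟨h, rfl⟩, hh⟩ := hx'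
  exact ⟨h, D.injective hh⟩

/-- A function on the edges that measures areas: the sum of the values of a function on the faces
can be read off from its differences across the edges. -/
lemma exists_sum_cograd_mul_eq :
    ∃ y : E → ℝ, ∀ h, ∑ e, M.cograd h e * y e = ∑ f, (h f - h M.outer) := by
  classical
  let ℓ : Module.Dual ℝ (F → ℝ) :=
    { toFun := fun h => ∑ f, (h f - h M.outer)
      map_add' := fun h h' => by
        rw [← Finset.sum_add_distrib]
        exact Finset.sum_congr rfl fun f _ => by simp only [Pi.add_apply]; ring
      map_smul' := fun a h => by
        rw [RingHom.id_apply, smul_eq_mul, Finset.mul_sum]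
        exact Finset.sum_congr rfl fun f _ => by simp only [Pi.smul_apply, smul_eq_mul]; ring }
  -- A functional factors through `cograd` as soon as it kills the kernel, which consists of
  -- constants.
  have hℓ : ℓ ∈ LinearMap.range M.cograd.dualMap := by
    rw [LinearMap.range_dualMap_eq_dualAnnihilator_ker, Submodule.mem_dualAnnihilator]
    intro h hh
    exact Finset.sum_eq_zero fun f _ => sub_eq_zero.2 (M.eq_of_cograd_eq_zero hh f M.outer)
  obtain ⟨y, hy⟩ := hℓ
  refine ⟨(dotProductEquiv ℝ E).symm y, fun h => ?_⟩
  have h1 : ∑ f, (h f - h M.outer) = y (M.cograd h) := (LinearMap.congr_fun hy h).symm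
  have h2 : dotProductEquiv ℝ E ((dotProductEquiv ℝ E).symm y) (M.cograd h) = y (M.cograd h) := by
    rw [LinearEquiv.apply_symm_apply]
  rw [h1, ← h2]
  exact Finset.sum_congr rfl fun e _ => mul_comm _ _

end Homology

/-! ### Simple cycles and the Jordan curve theorem -/

lemma IsSimpleCycle.sum_sub_eq_zero {V E F : Type*} [Finite V] [Finite E] [Finite F]
    {M : PlaneMap V E F} {n : ℕ} {c : Fin (n + 1) → Dart E} (hc : M.IsSimpleCycle c) (g : V → ℝ) :
    ∑ i, (g (M.org (c i)) - g (M.tgt (c i))) = 0 := by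
  rw [Finset.sum_sub_distrib, sub_eq_zero]
  simp only [hc.step]
  exact (Equiv.sum_comp (Equiv.addRight (1 : Fin (n + 1))) fun i => g (M.org (c i))).symm

namespace IsSimpleCycle

variable {V E F : Type*} [Fintype V] [Fintype E] [Fintype F] {M : PlaneMap V E F} {n : ℕ}
  {c : Fin (n + 1) → Dart E}

lemma sum_mul_eq (hc : M.IsSimpleCycle c) {x : E → ℝ}
    (hx : ∀ e ∉ Set.range fun j => (c j).1, x e = 0) (z : E → ℝ) :
    ∑ e, x e * z e = ∑ i, Dart.signed x (c i) * Dart.signed z (c i) :=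
  (Fintype.sum_of_injective _ hc.edge_inj _ _ (fun e he => by rw [hx e he, zero_mul])
    fun i => Dart.signed_mul_signed x z (c i)).symm

/-- A circulation supported by a simple cycle is constant along the cycle. -/
lemma signed_cograd_eq (hc : M.IsSimpleCycle c) {h : F → ℝ}
    (hh : ∀ e ∉ Set.range fun j => (c j).1, M.cograd h e = 0) (i : Fin (n + 1)) :
    Dart.signed (M.cograd h) (c i) = Dart.signed (M.cograd h) (c 0) := by
  classical
  refine Fin.apply_eq_apply_zero_of_sum_mul_sub (a := fun i => Dart.signed (M.cograd h) (c i)) ?_ i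
  set a := fun i => Dart.signed (M.cograd h) (c i) with ha
  -- The circulation is tested against its own values, placed at the origins of the half-edges; this
  -- is well defined because vertices do not repeat.
  let g : V → ℝ := Function.extend (fun i => M.org (c i)) a 0
  have hg (i : Fin (n + 1)) : g (M.org (c i)) = a i := hc.vertex_inj.extend_apply a 0 i
  rw [← M.sum_cograd_mul_grad h g, hc.sum_mul_eq hh]
  refine Finset.sum_congr rfl fun i _ => ?_
  rw [signed_grad, hc.step, hg, hg]

/-- A simple cycle separates some face from the outer face. -/
lemma exists_not_sameSide (hc : M.IsSimpleCycle c) :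
    ∃ f, ¬ M.SameSide (Set.range fun j => (c j).1) f M.outer := by
  classical
  by_contra! hall
  -- The unit flow around the cycle is a coboundary by planarity. If all faces were on one side, its
  -- face function would be constant and the flow zero.
  let x : E → ℝ :=
    Function.extend (fun i => (c i).1) (fun i => if (c i).2 then (1 : ℝ) else -1) 0
  have hx (e : E) (he : e ∉ Set.range fun j => (c j).1) : x e = 0 :=
    Function.extend_apply' _ _ _ he
  have hxc (i : Fin (n + 1)) : Dart.signed x (c i) = 1 := by
    have : x (c i).1 = if (c i).2 then (1 : ℝ) else -1 := hc.edge_inj.extend_apply _ _ i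
    rw [Dart.signed, this]
    split_ifs <;> norm_num
  obtain ⟨h, hh⟩ := M.exists_cograd_eq (x := x) fun g => by
    rw [hc.sum_mul_eq hx, ← hc.sum_sub_eq_zero g]
    exact Finset.sum_congr rfl fun i _ => by rw [hxc, one_mul, signed_grad]
  have hside (f f' : F) (hf : M.SameSide (Set.range fun j => (c j).1) f f') : h f = h f' := by
    induction hf with
    | refl => rfl
    | tail _ hstep ih =>
      obtain ⟨d, hd, rfl, rfl⟩ := hstep
      rw [ih, ← sub_eq_zero, ← M.signed_cograd, hh, Dart.signed, hx _ hd]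
      simp
  have := hxc 0
  rw [← hh, signed_cograd, hside _ _ (hall _), hside _ _ (hall (M.right _)), sub_self] at this
  exact zero_ne_one this

/-- Jordan curve theorem, with areas: if `y` measures areas, then the sign of its sum along a simple
cycle tells whether the cycle is clockwise or counterclockwise. -/
lemma sign_sum (hc : M.IsSimpleCycle c) {y : E → ℝ}
    (hy : ∀ h, ∑ e, M.cograd h e * y e = ∑ f, (h f - h M.outer)) :
    (∑ i, Dart.signed y (c i) < 0 ∧ M.IsClockwise c ∧ ¬ M.IsCounterclockwise c) ∨
      (0 < ∑ i, Dart.signed y (c i) ∧ ¬ M.IsClockwise c ∧ M.IsCounterclockwise c) := by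
  classical
  set S := Set.range fun j => (c j).1 with hS
  let h : F → ℝ := fun f => if M.SameSide S f M.outer then 1 else 0
  have hone {f : F} (hf : M.SameSide S f M.outer) : h f = 1 := if_pos hf
  have hzero {f : F} (hf : ¬ M.SameSide S f M.outer) : h f = 0 := if_neg hf
  have hle (f : F) : h f ≤ 1 := by
    by_cases hf : M.SameSide S f M.outer
    · exact (hone hf).le
    · exact (hzero hf).trans_le zero_le_one
  have houter : h M.outer = 1 := hone .refl
  have hcross (e : E) (he : e ∉ S) : M.cograd h e = 0 := by
    refine sub_eq_zero.2 (if_congr ⟨fun hf => ?_, fun hf => ?_⟩ rfl rfl)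
    · exact hf.head ⟨(e, false), he, rfl, rfl⟩
    · exact hf.head ⟨(e, true), he, rfl, rfl⟩
  obtain ⟨t, ht⟩ : ∃ t, ∀ i, h (M.left (c i)) - h (M.right (c i)) = t :=
    ⟨_, fun i => by rw [← signed_cograd, hc.signed_cograd_eq hcross i]⟩
  -- With `h` the indicator of the outer side, this product is minus the number of faces cut off
  -- from the outer face. In particular `t ≠ 0`, so exactly one side of the cycle is outer.
  have hsum : t * ∑ i, Dart.signed y (c i) < 0 := by
    have h1 : t * ∑ i, Dart.signed y (c i) = ∑ f, (h f - h M.outer) := by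
      rw [← hy, hc.sum_mul_eq hcross, Finset.mul_sum]
      exact Finset.sum_congr rfl fun i _ => by rw [signed_cograd, ht]
    obtain ⟨f, hf⟩ := hc.exists_not_sameSide
    rw [h1]
    refine Finset.sum_neg' (fun f _ => ?_) ⟨f, Finset.mem_univ f, ?_⟩
    · linarith [hle f]
    · rw [hzero hf, houter]
      norm_num
  by_cases hl : M.SameSide S (M.left (c 0)) M.outer <;>
    by_cases hr : M.SameSide S (M.right (c 0)) M.outer
  · rw [← ht 0, hone hl, hone hr] at hsum
    norm_num at hsum
  · left
    obtain rfl : t = 1 := by rw [← ht 0, hone hl, hzero hr, sub_zero]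
    refine ⟨by linarith, ⟨0, hl⟩, fun ⟨i, hi⟩ => ?_⟩
    have := ht i
    rw [hone hi] at this
    linarith [hle (M.left (c i))]
  · right
    obtain rfl : t = -1 := by rw [← ht 0, hzero hl, hone hr, zero_sub]
    refine ⟨by linarith, fun ⟨i, hi⟩ => ?_, ⟨0, hr⟩⟩
    have := ht i
    rw [hone hi] at this
    linarith [hle (M.right (c i))]
  · rw [← ht 0, hzero hl, hzero hr] at hsum
    norm_num at hsum

end IsSimpleCycle

/-- There is an antisymmetric function on the half-edges whose sum along a simple cycle is negative
if the cycle is clockwise and positive if it is counterclockwise. -/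
lemma exists_area {V E F : Type*} [Finite V] [Finite E] [Finite F] (M : PlaneMap V E F) :
    ∃ y : Dart E → ℝ, (∀ d, y d.rev = -y d) ∧
      ∀ (n : ℕ) (c : Fin (n + 1) → Dart E), M.IsSimpleCycle c →
        (∑ i, y (c i) < 0 ∧ M.IsClockwise c ∧ ¬ M.IsCounterclockwise c) ∨
          (0 < ∑ i, y (c i) ∧ ¬ M.IsClockwise c ∧ M.IsCounterclockwise c) := by
  cases nonempty_fintype V
  cases nonempty_fintype E
  cases nonempty_fintype F
  obtain ⟨y, hy⟩ := M.exists_sum_cograd_mul_eq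
  exact ⟨Dart.signed y, Dart.signed_rev y, fun n c hc => hc.sign_sum hy⟩

end PlaneMap

/-! ### Walks, their shortening, and longest walks -/

/-- If the images of the elements of a list are not distinct, then the list can be cut at two
elements with the same image. -/
lemma List.exists_split_of_not_nodup_map {α β : Type*} (f : α → β) {l : List α}
    (h : ¬ (l.map f).Nodup) :
    ∃ a x b x' b', l = a ++ (x :: b) ++ (x' :: b') ∧ f x = f x' := by
  induction l with
  | nil => simp at h
  | cons x l ih =>
    rw [List.map_cons, List.nodup_cons, not_and_or, not_not] at h
    rcases h with h | h
    · obtain ⟨x', hx', hf⟩ := List.mem_map.1 h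
      obtain ⟨b, b', rfl⟩ := List.append_of_mem hx'
      exact ⟨[], x, b, x', b', rfl, hf.symm⟩
    · obtain ⟨a, z, b, x', b', rfl, hf⟩ := ih h
      exact ⟨x :: a, z, b, x', b', rfl, hf⟩

lemma List.injective_of_nodup_map_cons {α β : Type*} (f : α → β) {a : α} {l : List α}
    (h : ((a :: l).map f).Nodup) :
    Function.Injective fun i : Fin (l.length + 1) => f (a :: l)[i] := by
  intro i j hij
  refine Fin.ext ((h.getElem_inj_iff (hi := ?_) (hj := ?_)).1 ?_)
  · rw [List.length_map]
    exact i.2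
  · rw [List.length_map]
    exact j.2
  · rw [List.getElem_map, List.getElem_map]
    exact hij

namespace PlaneMap

variable {V E F : Type*} [Finite V] [Finite E] [Finite F] (M : PlaneMap V E F)

/-- The list of half-edges is a walk from a vertex to another. -/
def IsWalk : V → List (Dart E) → V → Prop
  | u, [], v => u = v
  | u, d :: l, v => M.org d = u ∧ IsWalk (M.tgt d) l v

variable {M}

@[simp] lemma isWalk_nil {u v : V} : M.IsWalk u [] v ↔ u = v := Iff.rfl

@[simp] lemma isWalk_cons {u v : V} {d : Dart E} {l : List (Dart E)} :
    M.IsWalk u (d :: l) v ↔ M.org d = u ∧ M.IsWalk (M.tgt d) l v := Iff.rfl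

lemma isWalk_append {u v : V} {a b : List (Dart E)} :
    M.IsWalk u (a ++ b) v ↔ ∃ w, M.IsWalk u a w ∧ M.IsWalk w b v := by
  induction a generalizing u with
  | nil => simp
  | cons d a ih => simp [ih, and_assoc]

lemma tgt_rev (d : Dart E) : M.tgt d.rev = M.org d := by rw [tgt, Dart.rev_rev]

lemma exists_isWalk {P : Dart E → Prop} {u v : V}
    (h : Relation.ReflTransGen (fun a b => ∃ d, P d ∧ M.org d = a ∧ M.tgt d = b) u v) :
    ∃ l, M.IsWalk u l v ∧ ∀ d ∈ l, P d := by
  induction h using Relation.ReflTransGen.head_induction_on with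
  | refl => exact ⟨[], rfl, by simp⟩
  | head h _ ih =>
    obtain ⟨d, hd, rfl, rfl⟩ := h
    obtain ⟨l, hl, hP⟩ := ih
    exact ⟨d :: l, ⟨rfl, hl⟩, List.forall_mem_cons.2 ⟨hd, hP⟩⟩

lemma IsWalk.reflTransGen {P : Dart E → Prop} {u v : V} {l : List (Dart E)} (h : M.IsWalk u l v)
    (hP : ∀ d ∈ l, P d) :
    Relation.ReflTransGen (fun a b => ∃ d, P d ∧ M.org d = a ∧ M.tgt d = b) u v := by
  induction l generalizing u with
  | nil => exact h ▸ .refl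
  | cons d l ih =>
    rw [List.forall_mem_cons] at hP
    exact (ih h.2 hP.2).head ⟨d, hP.1, h.1, rfl⟩

lemma IsWalk.tgt_getElem {u v : V} {l : List (Dart E)} (h : M.IsWalk u l v) (i : ℕ)
    (hi : i < l.length) :
    M.tgt l[i] = if hi' : i + 1 < l.length then M.org l[i + 1] else v := by
  induction l generalizing u i with
  | nil => simp at hi
  | cons d l ih =>
    cases i with
    | zero =>
      cases l with
      | nil => exact h.2
      | cons d' l => exact h.2.1.symm
    | succ i =>
      have := ih h.2 i (by simpa using hi)
      simpa using this

lemma IsWalk.step {u : V} {d : Dart E} {l : List (Dart E)} (h : M.IsWalk u (d :: l) u)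
    (i : Fin (l.length + 1)) : M.tgt (d :: l)[i] = M.org (d :: l)[i + 1] := by
  have h1 := h.tgt_getElem i i.2
  rw [Fin.getElem_fin, h1]
  split_ifs with hi
  · have : ((i + 1 : Fin (l.length + 1)) : ℕ) = i + 1 := by
      rw [Fin.val_add_one_of_lt']
      exact hi
    simp only [Fin.getElem_fin, this]
  -- At the last index `i + 1` wraps around to `0`, and the walk is back at its start.
  · have : i = Fin.last l.length := by
      refine Fin.ext ?_
      have := i.2
      simp only [List.length_cons] at hi
      simp only [Fin.val_last]
      omega
    subst this
    simp only [Fin.last_add_one]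
    exact h.1.symm

/-- A closed walk without repetition of vertices is a simple cycle, or goes back and forth along an
edge. -/
lemma isSimpleCycle_or {n : ℕ} {c : Fin (n + 1) → Dart E}
    (hstep : ∀ i, M.tgt (c i) = M.org (c (i + 1)))
    (hinj : Function.Injective fun i => M.org (c i)) :
    M.IsSimpleCycle c ∨ (n = 1 ∧ ∀ i, c (i + 1) = (c i).rev) := by
  by_cases hedge : Function.Injective fun i => (c i).1
  · exact .inl ⟨hstep, hinj, hedge⟩
  right
  obtain ⟨i, j, hij, hne⟩ : ∃ i j, (c i).1 = (c j).1 ∧ i ≠ j := by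
    simpa [Function.Injective] using hedge
  -- Traversing an edge twice in the same direction would repeat its origin. Opposite traversals
  -- must follow each other both ways round, so the cycle has length two.
  have hrev : c i = (c j).rev := (Dart.eq_or_eq_rev hij).resolve_left fun h =>
    hne (hinj (congrArg M.org h))
  have hrev' : c j = (c i).rev := by rw [hrev, Dart.rev_rev]
  have hi : i + 1 = j := hinj (by
    change M.org (c (i + 1)) = M.org (c j)
    rw [← hstep, hrev, tgt_rev])
  have hj : j + 1 = i := hinj (by
    change M.org (c (j + 1)) = M.org (c i)
    rw [← hstep, hrev', tgt_rev])
  have hn : n = 1 := by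
    have h2 : (1 : Fin (n + 1)) + 1 = 0 := by
      have : i + (1 + 1) = i + 0 := by rw [← add_assoc, hi, hj, add_zero]
      exact add_left_cancel this
    have h1 : n ≠ 0 := by
      rintro rfl
      exact hne (Fin.ext (by omega))
    rcases n with _ | _ | n
    · exact absurd rfl h1
    · rfl
    · have := congrArg Fin.val h2
      rw [Fin.val_add_one_of_lt' (by simp)] at this
      simp at this
  subst hn
  refine ⟨rfl, fun m => ?_⟩
  have : m = i ∨ m = j := by omega
  rcases this with rfl | rfl
  · rw [hi, hrev']
  · rw [hj, hrev]

/-- If the sum of an antisymmetric function along the simple cycles in `P` is not positive, then its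
sum along the closed walks in `P` is not positive. -/
lemma sum_le_zero_of_isWalk {y : Dart E → ℝ} (hy : ∀ d, y d.rev = -y d) {P : Dart E → Prop}
    (hP : ∀ (n : ℕ) (c : Fin (n + 1) → Dart E), M.IsSimpleCycle c → (∀ i, P (c i)) →
      ∑ i, y (c i) ≤ 0)
    {u : V} {l : List (Dart E)} (hl : M.IsWalk u l u) (hlP : ∀ d ∈ l, P d) :
    (l.map y).sum ≤ 0 := by
  induction hn : l.length using Nat.strong_induction_on generalizing l u with
  | _ n ih =>
    subst hn
    by_cases hnd : (l.map M.org).Nodup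
    · cases l with
      | nil => simp
      | cons d l =>
        have hsum : ((d :: l).map y).sum = ∑ i : Fin (l.length + 1), y (d :: l)[i] :=
          (Fin.sum_univ_fun_getElem (d :: l) y).symm
        have hinj := List.injective_of_nodup_map_cons M.org hnd
        rw [hsum]
        rcases isSimpleCycle_or hl.step hinj with hc | ⟨_, hc⟩
        · exact hP _ _ hc fun i => hlP _ (List.getElem_mem _)
        -- Going back and forth, the cyclic shift negates every term, so the sum is zero.
        · have h1 := Equiv.sum_comp (Equiv.addRight (1 : Fin (l.length + 1)))
            fun i => y (d :: l)[i]
          have h2 : ∑ i : Fin (l.length + 1), y (d :: l)[i + 1] =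
              -∑ i : Fin (l.length + 1), y (d :: l)[i] := by
            rw [← Finset.sum_neg_distrib]
            exact Finset.sum_congr rfl fun i _ => by rw [hc i, hy]
          have h3 : ∑ i : Fin (l.length + 1), y (d :: l)[i + 1] =
              ∑ i : Fin (l.length + 1), y (d :: l)[i] := h1
          linarith
    · obtain ⟨a, x, b, x', b', rfl, hx⟩ := List.exists_split_of_not_nodup_map _ hnd
      obtain ⟨w', h1, hb'⟩ := isWalk_append.1 hl
      obtain ⟨w, ha, hb⟩ := isWalk_append.1 h1
      obtain rfl : w' = w := hb'.1.symm.trans (hx.symm.trans hb.1)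
      simp only [List.forall_mem_append] at hlP
      have h2 := ih _ (by simp; omega) hb hlP.1.2 rfl
      have h3 := ih _ (by simp) (isWalk_append.2 ⟨_, ha, hb'⟩)
        (List.forall_mem_append.2 ⟨hlP.1.1, hlP.2⟩) rfl
      simp only [List.map_append, List.sum_append] at h2 h3 ⊢
      linarith

/-- If the sum of `y` along closed walks in `P` is not positive, then a walk in `P` can be replaced
by a walk without repetition of vertices, without decreasing the sum of `y`. -/
lemma IsWalk.exists_nodup {y : Dart E → ℝ} {P : Dart E → Prop}
    (hP : ∀ (u : V) (l : List (Dart E)), M.IsWalk u l u → (∀ d ∈ l, P d) → (l.map y).sum ≤ 0)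
    {u v : V} {l : List (Dart E)} (hl : M.IsWalk u l v) (hlP : ∀ d ∈ l, P d) :
    ∃ l', M.IsWalk u l' v ∧ (∀ d ∈ l', P d) ∧ (l'.map M.org).Nodup ∧
      (l.map y).sum ≤ (l'.map y).sum := by
  induction hn : l.length using Nat.strong_induction_on generalizing l with
  | _ n ih =>
    subst hn
    by_cases hnd : (l.map M.org).Nodup
    · exact ⟨l, hl, hlP, hnd, le_rfl⟩
    · obtain ⟨a, x, b, x', b', rfl, hx⟩ := List.exists_split_of_not_nodup_map _ hnd
      obtain ⟨w', h1, hb'⟩ := isWalk_append.1 hl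
      obtain ⟨w, ha, hb⟩ := isWalk_append.1 h1
      obtain rfl : w' = w := hb'.1.symm.trans (hx.symm.trans hb.1)
      simp only [List.forall_mem_append] at hlP
      obtain ⟨l', h2, h3, h4, h5⟩ := ih _ (by simp) (isWalk_append.2 ⟨_, ha, hb'⟩)
        (List.forall_mem_append.2 ⟨hlP.1.1, hlP.2⟩) rfl
      refine ⟨l', h2, h3, h4, le_trans ?_ h5⟩
      have h6 := hP _ _ hb hlP.1.2
      simp only [List.map_append, List.sum_append] at h6 ⊢
      linarith

/-- If the sum of `y` along closed walks in `P` is not positive, then among the walks in `P` between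
two vertices there is one with the largest sum. -/
lemma exists_isWalk_max {y : Dart E → ℝ} {P : Dart E → Prop}
    (hP : ∀ (u : V) (l : List (Dart E)), M.IsWalk u l u → (∀ d ∈ l, P d) → (l.map y).sum ≤ 0)
    {u v : V} (h : ∃ l, M.IsWalk u l v ∧ ∀ d ∈ l, P d) :
    ∃ l, M.IsWalk u l v ∧ (∀ d ∈ l, P d) ∧
      ∀ l', M.IsWalk u l' v → (∀ d ∈ l', P d) → (l'.map y).sum ≤ (l.map y).sum := by
  cases nonempty_fintype V
  let W : Set (List (Dart E)) :=
    {l | M.IsWalk u l v ∧ (∀ d ∈ l, P d) ∧ (l.map M.org).Nodup}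
  -- Distinct origins bound the length by the number of vertices, so only finitely many walks
  -- compete.
  have hfin : W.Finite := by
    refine (List.finite_length_le (Dart E) (Fintype.card V)).subset fun l hl => ?_
    simpa using hl.2.2.length_le_card
  obtain ⟨l₀, hl₀, hl₀P⟩ := h
  obtain ⟨l₁, h1, h2, h3, -⟩ := hl₀.exists_nodup hP hl₀P
  obtain ⟨l, hl, hmax⟩ := Set.exists_max_image W (fun l => (l.map y).sum) hfin ⟨l₁, h1, h2, h3⟩
  refine ⟨l, hl.1, hl.2.1, fun l' hl' hl'P => ?_⟩
  obtain ⟨l₂, h4, h5, h6, h7⟩ := hl'.exists_nodup hP hl'P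
  exact h7.trans (hmax l₂ ⟨h4, h5, h6⟩)

/-- An edge whose endpoints are joined by a walk in a set of edges that does not contain it belongs
to a simple cycle whose other edges are in this set. -/
lemma IsWalk.exists_isSimpleCycle {T : Set E} {d : Dart E} (hd : d.1 ∉ T) {l : List (Dart E)}
    (hl : M.IsWalk (M.tgt d) l (M.org d)) (hlT : ∀ x ∈ l, x.1 ∈ T) :
    ∃ (n : ℕ) (c : Fin (n + 1) → Dart E), M.IsSimpleCycle c ∧ c 0 = d ∧
      ∀ i, i ≠ 0 → (c i).1 ∈ T := by
  induction hn : l.length using Nat.strong_induction_on generalizing l with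
  | _ n ih =>
    subst hn
    by_cases hnd : ((d :: l).map M.org).Nodup
    · have hinj := List.injective_of_nodup_map_cons M.org hnd
      have hmem (i : Fin (l.length + 1)) (hi : i ≠ 0) : (d :: l)[i].1 ∈ T := by
        obtain ⟨i, rfl⟩ := Fin.exists_succ_eq_of_ne_zero hi
        exact hlT _ (by simp)
      have hwalk : M.IsWalk (M.org d) (d :: l) (M.org d) := ⟨rfl, hl⟩
      rcases isSimpleCycle_or hwalk.step hinj with hc | ⟨hlen, hc⟩
      · exact ⟨l.length, _, hc, rfl, hmem⟩
      -- Backtracking would make the second half-edge `d.rev`, whose edge is not in `T`.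
      · refine absurd (hmem (0 + 1) ?_) ?_
        · have : l.length ≠ 0 := by omega
          simpa [Fin.ext_iff] using this
        · rw [hc 0]
          exact hd
    · rw [List.map_cons, List.nodup_cons, not_and_or, not_not] at hnd
      rcases hnd with h | h
      · obtain ⟨x, hx, hdx⟩ := List.mem_map.1 h
        obtain ⟨b, b', rfl⟩ := List.append_of_mem hx
        obtain ⟨w, hb, hb'⟩ := isWalk_append.1 hl
        obtain rfl : w = M.org d := hb'.1.symm.trans hdx
        exact ih _ (by simp) hb (List.forall_mem_append.1 hlT).1 rfl
      · obtain ⟨a, x, b, x', b', rfl, hx⟩ := List.exists_split_of_not_nodup_map _ h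
        obtain ⟨w', h1, hb'⟩ := isWalk_append.1 hl
        obtain ⟨w, ha, hb⟩ := isWalk_append.1 h1
        obtain rfl : w' = w := hb'.1.symm.trans (hx.symm.trans hb.1)
        simp only [List.forall_mem_append] at hlT
        exact ih _ (by simp) (isWalk_append.2 ⟨_, ha, hb'⟩)
          (List.forall_mem_append.2 ⟨hlT.1.1, hlT.2⟩) rfl

end PlaneMap

lemma List.sum_map_neg_eq {α : Type*} (y : α → ℝ) (l : List α) :
    (l.map fun d => -y d).sum = -(l.map y).sum := by
  induction l with
  | nil => simp
  | cons d l ih => rw [List.map_cons, List.sum_cons, ih, List.map_cons, List.sum_cons, neg_add]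

namespace FracOrientation

variable {E : Type*} {k : ℕ}

lemma exists_along (hk : 0 < k) (O : FracOrientation E k) (e : E) :
    ∃ d : Dart E, d.1 = e ∧ O.Along d := by
  have h := O.weight_add (e, true)
  by_cases h1 : O.Along (e, true)
  · exact ⟨_, rfl, h1⟩
  · refine ⟨Dart.rev (e, true), rfl, ?_⟩
    unfold FracOrientation.Along at h1 ⊢
    omega

lemma saturatedAlong_of_not_along_rev {O : FracOrientation E k} {d : Dart E}
    (h : ¬ O.Along d.rev) : O.SaturatedAlong d := by
  have h1 := O.weight_add d
  unfold FracOrientation.Along at h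
  unfold FracOrientation.SaturatedAlong
  omega

end FracOrientation

/-! ### Tight edges, the maximal potential, and the partition -/

namespace PlaneMap

section Partition

variable {V E F : Type*} [Finite V] [Finite E] [Finite F] {M : PlaneMap V E F} {k : ℕ}
  {O : FracOrientation E k} {r : V} {y : Dart E → ℝ} {p : V → ℝ}

/-- The edges along which the potential `p` varies by the value of the antisymmetric function
`y`. -/
def tightEdges (M : PlaneMap V E F) (y : Dart E → ℝ) (p : V → ℝ) : Set E :=
  {e | y (e, true) = p (M.org (e, true)) - p (M.tgt (e, true))}

lemma mem_tightEdges (hy : ∀ d, y d.rev = -y d) {d : Dart E} :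
    d.1 ∈ M.tightEdges y p ↔ y d = p (M.org d) - p (M.tgt d) := by
  obtain ⟨e, b⟩ := d
  cases b
  · have h1 : y (e, false) = -y (e, true) := hy (e, true)
    change y (e, true) = p (M.org (e, true)) - p (M.org (e, false)) ↔
      y (e, false) = p (M.org (e, false)) - p (M.org (e, true))
    rw [h1]
    constructor <;> intro h <;> linarith
  · rfl

/-- If all the edges of a simple cycle but one are tight, then the sum of `y` along the cycle is
the defect of the potential along this edge. -/
lemma IsSimpleCycle.sum_eq_defect {n : ℕ} {c : Fin (n + 1) → Dart E} (hc : M.IsSimpleCycle c)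
    {i : Fin (n + 1)} (hi : ∀ j, j ≠ i → y (c j) = p (M.org (c j)) - p (M.tgt (c j))) :
    ∑ j, y (c j) = y (c i) - (p (M.org (c i)) - p (M.tgt (c i))) := by
  have h1 : ∑ j, y (c j) = ∑ j, (y (c j) - (p (M.org (c j)) - p (M.tgt (c j)))) := by
    rw [Finset.sum_sub_distrib, hc.sum_sub_eq_zero, sub_zero]
  rw [h1]
  exact Fintype.sum_eq_single i fun j hj => sub_eq_zero.2 (hi j hj)

lemma IsWalk.sum_le {u v : V} {l : List (Dart E)} (hl : M.IsWalk u l v)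
    (h : ∀ d ∈ l, y d ≤ p (M.org d) - p (M.tgt d)) : (l.map y).sum ≤ p u - p v := by
  induction l generalizing u with
  | nil => simp [show u = v from hl]
  | cons d l ih =>
    rw [List.forall_mem_cons] at h
    have h1 := ih hl.2 h.2
    have h2 := hl.1
    subst h2
    rw [List.map_cons, List.sum_cons]
    linarith [h.1]

lemma IsWalk.sum_eq {u v : V} {l : List (Dart E)} (hl : M.IsWalk u l v)
    (h : ∀ d ∈ l, y d = p (M.org d) - p (M.tgt d)) : (l.map y).sum = p u - p v := by
  refine le_antisymm (hl.sum_le fun d hd => (h d hd).le) ?_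
  have h1 := hl.sum_le (y := fun d => -y d) (p := fun v => -p v) fun d hd => by
    rw [h d hd]
    linarith
  rw [List.sum_map_neg_eq] at h1
  linarith

/-- A spanning tree carries a potential whose differences are the given antisymmetric function. -/
lemma IsSpanningTree.exists_potential {T : Set E} (hT : M.IsSpanningTree T)
    (hy : ∀ d, y d.rev = -y d) :
    ∃ p : V → ℝ, ∀ d : Dart E, d.1 ∈ T → y d = p (M.org d) - p (M.tgt d) := by
  have hclosed (u : V) (l : List (Dart E)) (hl : M.IsWalk u l u) (hlT : ∀ d ∈ l, d.1 ∈ T) :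
      (l.map y).sum = 0 := by
    -- There are no simple cycles in `T`, so the bound on closed walks applies vacuously to both `y`
    -- and `-y`.
    refine le_antisymm (sum_le_zero_of_isWalk hy (fun n c hc hcT =>
      absurd ⟨n, c, hc, hcT⟩ hT.acyclic) hl hlT) ?_
    have h1 := sum_le_zero_of_isWalk (y := fun d => -y d) (fun d => by rw [hy])
      (fun n c hc hcT => absurd ⟨n, c, hc, hcT⟩ hT.acyclic) hl hlT
    rw [List.sum_map_neg_eq] at h1
    linarith
  have ⟨r⟩ := M.nonempty
  choose a ha haT using fun v => exists_isWalk (P := fun d : Dart E => d.1 ∈ T) (hT.connected v r)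
  choose b hb hbT using fun v => exists_isWalk (P := fun d : Dart E => d.1 ∈ T) (hT.connected r v)
  refine ⟨fun v => ((a v).map y).sum, fun d hd => ?_⟩
  -- Two closed walks share the return from `r` to `M.org d`: one goes out along `a (M.org d)`, the
  -- other along `d` and then `a (M.tgt d)`. Comparing them gives the difference of `p` along `d`.
  have h1 := hclosed _ _ (isWalk_append.2 ⟨_, ha (M.org d), hb (M.org d)⟩)
    (List.forall_mem_append.2 ⟨haT _, hbT _⟩)
  have h2 := hclosed _ (d :: (a (M.tgt d) ++ b (M.org d)))
    ⟨rfl, isWalk_append.2 ⟨_, ha (M.tgt d), hb (M.org d)⟩⟩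
    (List.forall_mem_cons.2 ⟨hd, List.forall_mem_append.2 ⟨haT _, hbT _⟩⟩)
  simp only [List.map_append, List.map_cons, List.sum_append, List.sum_cons] at h1 h2
  linarith

/-- The function `p` gives the largest sum of `y` along an oriented path to the root. -/
structure IsMaxPotential (M : PlaneMap V E F) (O : FracOrientation E k) (r : V) (y : Dart E → ℝ)
    (p : V → ℝ) : Prop where
  sum_le : ∀ (u : V) (l : List (Dart E)), M.IsWalk u l r → (∀ d ∈ l, O.Along d) →
    (l.map y).sum ≤ p u
  exists_eq : ∀ u : V, ∃ l, M.IsWalk u l r ∧ (∀ d ∈ l, O.Along d) ∧ (l.map y).sum = p u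

lemma exists_isMaxPotential (hy : ∀ d, y d.rev = -y d)
    (hcycle : ∀ (n : ℕ) (c : Fin (n + 1) → Dart E), M.IsSimpleCycle c → (∀ i, O.Along (c i)) →
      ∑ i, y (c i) ≤ 0) (hacc : M.Accessible O r) : ∃ p, M.IsMaxPotential O r y p := by
  have h (v : V) : ∃ l, M.IsWalk v l r ∧ ∀ d ∈ l, O.Along d := by
    obtain ⟨l, hl, hlP⟩ := exists_isWalk (M := M) (P := O.Along)
      (Relation.ReflTransGen.mono (fun _ _ ⟨d, _, hd⟩ => ⟨d, hd⟩) _ _ (hacc v))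
    exact ⟨l, hl, hlP⟩
  choose l hl hlP hmax using fun v => exists_isWalk_max (y := y)
    (fun u l hl hlP => sum_le_zero_of_isWalk hy hcycle hl hlP) (h v)
  exact ⟨fun v => ((l v).map y).sum, hmax, fun u => ⟨l u, hl u, hlP u, rfl⟩⟩

namespace IsMaxPotential

lemma le_sub (hp : M.IsMaxPotential O r y p) {d : Dart E} (hd : O.Along d) :
    y d ≤ p (M.org d) - p (M.tgt d) := by
  obtain ⟨l, hl, hlP, hsum⟩ := hp.exists_eq (M.tgt d)
  have := hp.sum_le _ (d :: l) ⟨rfl, hl⟩ (List.forall_mem_cons.2 ⟨hd, hlP⟩)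
  rw [List.map_cons, List.sum_cons] at this
  linarith

/-- Every tail of a longest walk is itself longest, so no step can lose against the bound `le_sub`.
-/
lemma tight_of_sum_eq (hp : M.IsMaxPotential O r y p) {u : V} {l : List (Dart E)}
    (hl : M.IsWalk u l r) (hlP : ∀ d ∈ l, O.Along d) (hsum : (l.map y).sum = p u) :
    ∀ d ∈ l, y d = p (M.org d) - p (M.tgt d) := by
  induction l generalizing u with
  | nil => simp
  | cons d l ih =>
    rw [List.forall_mem_cons] at hlP
    obtain ⟨rfl, hl⟩ := hl
    have h1 := hp.le_sub hlP.1
    have h2 := hp.sum_le _ l hl hlP.2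
    rw [List.map_cons, List.sum_cons] at hsum
    exact List.forall_mem_cons.2 ⟨by linarith, ih hl hlP.2 (by linarith)⟩

lemma accessibleOn (hp : M.IsMaxPotential O r y p) (hy : ∀ d, y d.rev = -y d) :
    M.AccessibleOn O r (M.tightEdges y p) := by
  intro v
  obtain ⟨l, hl, hlP, hsum⟩ := hp.exists_eq v
  have := hl.reflTransGen (P := fun d => d.1 ∈ M.tightEdges y p ∧ O.Along d) fun d hd =>
    ⟨(mem_tightEdges hy).2 (hp.tight_of_sum_eq hl hlP hsum d hd), hlP d hd⟩
  exact Relation.ReflTransGen.mono (fun _ _ ⟨d, ⟨h1, h2⟩, h3⟩ => ⟨d, h1, h2, h3⟩) _ _ this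

lemma isSpanningTree (hp : M.IsMaxPotential O r y p) (hy : ∀ d, y d.rev = -y d)
    (hne : ∀ (n : ℕ) (c : Fin (n + 1) → Dart E), M.IsSimpleCycle c → ∑ i, y (c i) ≠ 0) :
    M.IsSpanningTree (M.tightEdges y p) where
  connected u v := by
    let R : V → V → Prop := fun a b =>
      ∃ d : Dart E, d.1 ∈ M.tightEdges y p ∧ M.org d = a ∧ M.tgt d = b
    have hR : Std.Symm R := ⟨by
      rintro _ _ ⟨d, hd, rfl, rfl⟩
      exact ⟨d.rev, hd, rfl, tgt_rev d⟩⟩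
    have h (w : V) : Relation.ReflTransGen R w r :=
      Relation.ReflTransGen.mono (fun _ _ ⟨d, h1, _, h3⟩ => ⟨d, h1, h3⟩) _ _
        (hp.accessibleOn hy w)
    exact (h u).trans (Std.Symm.symm _ _ (h v))
  acyclic := by
    rintro ⟨n, c, hc, hcT⟩
    refine hne n c hc ?_
    rw [← hc.sum_sub_eq_zero p]
    exact Finset.sum_congr rfl fun i _ => (mem_tightEdges hy).1 (hcT i)

end IsMaxPotential

/-- The edges that are not tight for the maximal potential are closure edges. -/
lemma IsMaxPotential.isTreeClosurePartition (hp : M.IsMaxPotential O r y p) (hk : 0 < k)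
    (hy : ∀ d, y d.rev = -y d)
    (hsign : ∀ (n : ℕ) (c : Fin (n + 1) → Dart E), M.IsSimpleCycle c →
      ∑ i, y (c i) < 0 ∧ M.IsClockwise c ∨ 0 < ∑ i, y (c i)) :
    M.IsTreeClosurePartition O r (M.tightEdges y p) (M.tightEdges y p)ᶜ where
  union_eq := Set.union_compl_self _
  disjoint := disjoint_compl_right
  tree := hp.isSpanningTree hy fun n c hc =>
    (hsign n c hc).elim (fun h => h.1.ne) fun h => h.ne'
  accessible := hp.accessibleOn hy
  closure e he := by
    have htree := hp.isSpanningTree hy fun n c hc =>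
      (hsign n c hc).elim (fun h => h.1.ne) fun h => h.ne'
    obtain ⟨d, rfl, hd⟩ := O.exists_along hk e
    have hlt : y d < p (M.org d) - p (M.tgt d) :=
      lt_of_le_of_ne (hp.le_sub hd) fun h => he ((mem_tightEdges hy).2 h)
    refine ⟨d, rfl, FracOrientation.saturatedAlong_of_not_along_rev fun hrev => ?_, ?_⟩
    -- If both directions were available, the two opposite bounds would force tightness.
    · have := hp.le_sub hrev
      rw [hy, tgt_rev] at this
      change -y d ≤ p (M.tgt d) - p (M.org d) at this
      linarith
    · obtain ⟨l, hl, hlT⟩ := exists_isWalk (P := fun x : Dart E => x.1 ∈ M.tightEdges y p)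
        (htree.connected (M.tgt d) (M.org d))
      obtain ⟨n, c, hc, hc0, hcT⟩ := hl.exists_isSimpleCycle he hlT
      refine ⟨n, c, hc, ⟨0, hc0⟩, fun i => ?_, ?_⟩
      · by_cases hi : i = 0
        · rw [hi, hc0]
          exact Set.mem_insert _ _
        · exact Set.mem_insert_of_mem _ (hcT i hi)
      -- Only `d` contributes a defect, which is negative; this rules out the positive alternative
      -- in `hsign`.
      · have hsum := hc.sum_eq_defect (y := y) (p := p) (i := 0) fun j hj =>
          (mem_tightEdges hy).1 (hcT j hj)
        rw [hc0] at hsum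
        rcases hsign n c hc with h | h
        · exact h.2
        · linarith

/-! ### Uniqueness -/

namespace IsTreeClosurePartition

variable {T C : Set E}

/-- The tree edges are tight for the maximal potential. -/
lemma subset_tightEdges (h : M.IsTreeClosurePartition O r T C) (hp : M.IsMaxPotential O r y p)
    (hy : ∀ d, y d.rev = -y d)
    (hneg : ∀ (n : ℕ) (c : Fin (n + 1) → Dart E), M.IsSimpleCycle c → M.IsClockwise c →
      ∑ i, y (c i) < 0) : T ⊆ M.tightEdges y p := by
  obtain ⟨q, hq⟩ := h.tree.exists_potential hy
  -- On a closure edge the only available direction is the saturated one, and the defect of `q`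
  -- there is the sum of `y` along a clockwise cycle.
  have hle (d : Dart E) (hd : O.Along d) : y d ≤ q (M.org d) - q (M.tgt d) := by
    by_cases hdT : d.1 ∈ T
    · exact (hq d hdT).le
    have hdC : d.1 ∈ C := ((Set.ext_iff.1 h.union_eq d.1).2 trivial).resolve_left hdT
    obtain ⟨d', hd', hsat, n, c, hc, ⟨i, rfl⟩, hcT, hcw⟩ := h.closure _ hdC
    obtain rfl : d = c i := by
      refine (Dart.eq_or_eq_rev hd'.symm).resolve_right fun hrev => ?_
      have h1 := O.weight_add (c i)
      rw [← hrev, show O.weight (c i) = k from hsat] at h1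
      have h2 : 0 < O.weight d := hd
      omega
    have hsum := hc.sum_eq_defect (y := y) (p := q) (i := i) fun j hj =>
      hq _ ((hcT j).resolve_left fun hji => hj (hc.edge_inj hji))
    linarith [hneg n c hc hcw]
  -- By `hle`, `q u - q r` bounds every oriented walk from `u` to `r`; the oriented path in the tree
  -- attains it.
  have hpq (u : V) : p u = q u - q r := by
    refine le_antisymm ?_ ?_
    · obtain ⟨l, hl, hlP, hsum⟩ := hp.exists_eq u
      rw [← hsum]
      exact hl.sum_le fun d hd => hle d (hlP d hd)
    · obtain ⟨l, hl, hlP⟩ := exists_isWalk (M := M) (P := fun d => d.1 ∈ T ∧ O.Along d)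
        (Relation.ReflTransGen.mono (fun _ _ ⟨d, h1, h2, h3⟩ => ⟨d, ⟨h1, h2⟩, h3⟩) _ _
          (h.accessible u))
      rw [← hl.sum_eq fun d hd => hq d (hlP d hd).1]
      exact hp.sum_le u l hl fun d hd => (hlP d hd).2
  intro e he
  refine (mem_tightEdges hy (d := (e, true))).2 ?_
  rw [hq (e, true) he, hpq, hpq]
  ring

/-- An extra edge of `T'` would be a closure edge, and its cycle with `T` would lie in `T'`. -/
lemma eq_of_subset (h : M.IsTreeClosurePartition O r T C) {T' : Set E} (hT' : M.IsSpanningTree T')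
    (hsub : T ⊆ T') : T = T' := by
  refine hsub.antisymm fun e he => ?_
  by_contra heT
  have heC : e ∈ C := ((Set.ext_iff.1 h.union_eq e).2 trivial).resolve_left heT
  obtain ⟨_, _, _, n, c, hc, _, hcT, _⟩ := h.closure e heC
  exact hT'.acyclic ⟨n, c, hc, fun i => Set.insert_subset he hsub (hcT i)⟩

end IsTreeClosurePartition

end Partition

end PlaneMap

theorem theorem2p1 {V E F : Type*} [Finite V] [Finite E] [Finite F] (M : PlaneMap V E F) (r : V)
    {k : ℕ} (hk : 0 < k) (O : FracOrientation E k) (hmin : M.Minimal O)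
    (hacc : M.Accessible O r) :
    ∃! P : Set E × Set E, M.IsTreeClosurePartition O r P.1 P.2 := by
  obtain ⟨y, hy, harea⟩ := M.exists_area
  obtain ⟨p, hp⟩ := PlaneMap.exists_isMaxPotential (M := M) (O := O) (r := r) hy
    -- Minimality enters only here: an oriented cycle of positive sum would be counterclockwise.
    (fun n c hc hcO => (harea n c hc).elim (fun h => h.1.le) fun h =>
      absurd ⟨n, c, hc, hcO, h.2.2⟩ hmin) hacc
  have hpart := hp.isTreeClosurePartition hk hy fun n c hc =>
    (harea n c hc).imp (fun h => ⟨h.1, h.2.1⟩) fun h => h.1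
  refine ⟨(M.tightEdges y p, (M.tightEdges y p)ᶜ), hpart, ?_⟩
  rintro ⟨T, C⟩ h
  have hT : T = M.tightEdges y p := h.eq_of_subset hpart.tree <|
    h.subset_tightEdges hp hy fun n c hc hcw =>
      (harea n c hc).elim (fun h => h.1) fun h => absurd hcw h.2.1
  have hC : C = Tᶜ := (IsCompl.of_eq (disjoint_iff.1 h.disjoint) h.union_eq).compl_eq.symm
  rw [hC, hT]
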